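/- A binary word is a finite sequence over $\{0,1\}$. For a positive integer $t$ and a binary word $x$, let $\mathrm{dS}^t(x)$ be the set of words obtained from $x$ by deleting exactly $t$ letters. A set $C\subseteq\{0,1\}^n$ is a $t$-deletion code of length $n$ if $\mathrm{dS}^t(c)\cap \mathrm{dS}^t(d)=\emptyset$ for all distinct $c,d\in C$; it is perfect if, moreover, $n\ge t$ and $\bigcup_{c\in C}\mathrm{dS}^t(c)=\{0,1\}^{n-t}$. Let $M^t(n)$ be the maximum cardinality of a $t$-deletion code of length $n$. Theorem. Let $t$ be a positive integer, let $A$ be an infinite set of positive integers (for example, the set of all $n\ge t$), and suppose that for every $n\in A$ a perfect $t$-deletion code $C_n$ of length $n$ is given. Then, as $n\to\infty$ within $A$, $$\# C_n \sim M^t(n)\sim \frac{t!\,2^n}{n^t},$$ that is, $\displaystyle\lim_{n\to\infty,\ n\in A}\frac{\# C_n}{M^t(n)}=1$ and $\displaystyle\lim_{n\to\infty,\ n\in A}\frac{M^t(n)}{t!\,2^n/n^t}=1$. -/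

import Mathlib

open Filter Topology

/-- The set `𝔹ⁿ` of binary words of length `n`; a binary word is a list of Booleans. -/
def binaryWords (n : ℕ) : Set (List Bool) := {x | x.length = n}

/-- The deletion sphere `dSᵗ(x)`: all words obtained from `x` by deleting exactly `t` letters,
that is, the (not necessarily contiguous) subsequences of `x` with `t` letters fewer than `x`. -/
def deletionSphere (t : ℕ) (x : List Bool) : Set (List Bool) :=
  {y | y.Sublist x ∧ y.length + t = x.length}

/-- `dSᵗ(X)`, the union of the deletion spheres of the words in `X`. -/
def deletionSphereSet (t : ℕ) (X : Set (List Bool)) : Set (List Bool) :=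
  ⋃ x ∈ X, deletionSphere t x

/-- A `t`-deletion code: distinct codewords have disjoint deletion spheres. -/
def IsDeletionCode (t : ℕ) (C : Set (List Bool)) : Prop :=
  ∀ c ∈ C, ∀ d ∈ C, c ≠ d → deletionSphere t c ∩ deletionSphere t d = ∅

/-- A `t`-deletion code of length `n`. -/
def IsDeletionCodeOfLength (t n : ℕ) (C : Set (List Bool)) : Prop :=
  IsDeletionCode t C ∧ C ⊆ binaryWords n

/-- A perfect `t`-deletion code of length `n` (where `t ≤ n`): a `t`-deletion code of length `n`
whose deletion spheres cover all words of length `n - t`. -/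
def IsPerfectDeletionCode (t n : ℕ) (C : Set (List Bool)) : Prop :=
  t ≤ n ∧ IsDeletionCodeOfLength t n C ∧ deletionSphereSet t C = binaryWords (n - t)

/-- `Mᵗ(n)`, the maximum cardinality of a `t`-deletion code of length `n`. -/
noncomputable def maxDeletionCodeCard (t n : ℕ) : ℕ :=
  sSup {k | ∃ C : Set (List Bool), IsDeletionCodeOfLength t n C ∧ C.ncard = k}

/-- The supremum defining `Mᵗ(n)` is a maximum. -/
theorem isGreatest_maxDeletionCodeCard (t n : ℕ) :
    IsGreatest {k | ∃ C : Set (List Bool), IsDeletionCodeOfLength t n C ∧ C.ncard = k}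
      (maxDeletionCodeCard t n) := by
  have hfin : (binaryWords n).Finite := List.finite_length_eq Bool n
  have hbdd : BddAbove
      {k | ∃ C : Set (List Bool), IsDeletionCodeOfLength t n C ∧ C.ncard = k} := by
    refine ⟨(binaryWords n).ncard, ?_⟩
    rintro k ⟨C, hC, rfl⟩
    exact Set.ncard_le_ncard hC.2 hfin
  refine ⟨Nat.sSup_mem ⟨0, ∅, ⟨?_, Set.empty_subset _⟩, Set.ncard_empty _⟩ hbdd,
    fun k hk => le_csSup hbdd hk⟩
  intro c hc
  exact absurd hc (Set.notMem_empty c)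

/-!
The deletion spheres of the words of a `t`-deletion code of length `n` are disjoint subsets of the
`2 ^ (n - t)` words of length `n - t`, and they exhaust these words if the code is perfect. So the
size of the code is governed by the size of a typical sphere.

If `x` has `r` runs, then `C(r - t, t) ≤ |dSᵗ(x)| ≤ C(r + t - 1, t)`
(`choose_le_ncard_deletionSphere`, `ncard_deletionSphere_le_multichoose`); these bounds are
`(1 + o(1)) rᵗ / t!`. Almost all words have about `n / 2` runs: the sum of
`cosh (s (2 r(x) - n))` over all words `x` of length `n` is exactly `(2 cosh s) ^ n`
(`sum_cosh_numRuns`), and Markov's inequality with `s = n ^ (-1/4)` shows that all but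
`2 ^ (n + 1) exp (-√n / 2)` words satisfy `|2 r(x) - n| < n ^ (3/4)` (`ncard_atypicalWords_le`).
This exceptional set is negligible even after multiplication by a power of `n`, and a typical
sphere has size `(1 + o(1)) (n / 2)ᵗ / t!`.

Hence any `t`-deletion code has at most `(1 + o(1)) t! 2 ^ n / nᵗ` words
(`IsDeletionCodeOfLength.ncard_div_le`), while a perfect one has at least
`(1 - o(1)) t! 2 ^ n / nᵗ` words (`IsPerfectDeletionCode.le_ncard_div`). Since `#Cₙ ≤ Mᵗ(n)`, both
quantities are squeezed.
-/

/-! ### Words and deletion spheres -/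

theorem finite_binaryWords (n : ℕ) : (binaryWords n).Finite := List.finite_length_eq Bool n

theorem ncard_binaryWords (n : ℕ) : (binaryWords n).ncard = 2 ^ n := by
  rw [← Nat.card_coe_set_eq]
  have : Nat.card (List.Vector Bool n) = 2 ^ n := by
    rw [Nat.card_eq_fintype_card, card_vector, Fintype.card_bool]
  exact this

theorem deletionSphere_subset_binaryWords (t : ℕ) (x : List Bool) :
    deletionSphere t x ⊆ binaryWords (x.length - t) := by
  rintro y ⟨-, hy⟩
  simp only [binaryWords, Set.mem_ofPred_eq]
  omega

theorem finite_deletionSphere (t : ℕ) (x : List Bool) : (deletionSphere t x).Finite :=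
  (finite_binaryWords _).subset (deletionSphere_subset_binaryWords t x)

theorem deletionSphere_zero (x : List Bool) : deletionSphere 0 x = {x} := by
  ext y
  constructor
  · rintro ⟨h, hl⟩
    exact h.eq_of_length (by omega)
  · rintro rfl
    exact ⟨List.Sublist.refl _, rfl⟩

/-! ### Runs and the size of a deletion sphere -/

/-- The number of runs (maximal blocks of equal consecutive letters) of a binary word. -/
def numRuns : List Bool → ℕ
  | [] => 0
  | [_] => 1
  | a :: b :: l => numRuns (b :: l) + if a = b then 0 else 1

theorem numRuns_le_numRuns_cons (a : Bool) (l : List Bool) : numRuns l ≤ numRuns (a :: l) := by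
  cases l <;> simp [numRuns]

theorem numRuns_cons_le (a : Bool) (l : List Bool) : numRuns (a :: l) ≤ numRuns l + 1 := by
  cases l with
  | nil => simp [numRuns]
  | cons b l => simp only [numRuns]; split_ifs <;> omega

theorem one_le_numRuns_cons (a : Bool) (l : List Bool) : 1 ≤ numRuns (a :: l) := by
  induction l generalizing a with
  | nil => simp [numRuns]
  | cons b l ih => exact (ih b).trans (numRuns_le_numRuns_cons a _)

theorem numRuns_le_length (x : List Bool) : numRuns x ≤ x.length := by
  induction x with
  | nil => simp [numRuns]
  | cons a l ih => exact (numRuns_cons_le a l).trans (by simpa using ih)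

theorem multichoose_le_multichoose_left {r s : ℕ} (h : r ≤ s) (t : ℕ) :
    Nat.multichoose r t ≤ Nat.multichoose s t := by
  rw [Nat.multichoose_eq, Nat.multichoose_eq]
  exact Nat.choose_le_choose t (by omega)

theorem cons_image_deletionSphere_subset (a : Bool) (x : List Bool) (t : ℕ) :
    List.cons a '' deletionSphere t x ⊆ deletionSphere t (a :: x) := by
  rintro _ ⟨y, ⟨hy, hl⟩, rfl⟩
  exact ⟨hy.cons_cons a, by simp only [List.length_cons]; omega⟩

/-- Lower bound for a deletion sphere. If `x` begins with `a :: b :: l` and `a ≠ b`, then the sphere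
contains the words `a :: y` with `y ∈ dSᵗ(b :: l)` and the words `b :: z` with `z ∈ dSᵗ⁻¹(l)`, which
gives the Pascal recursion. The truncated subtraction only replaces the bound by `0` (for
`t > 0`) when `x` has few runs. -/
theorem choose_le_ncard_deletionSphere (x : List Bool) (t : ℕ) :
    (numRuns x - t).choose t ≤ (deletionSphere t x).ncard := by
  induction x using List.twoStepInduction generalizing t with
  | nil => cases t <;> simp [numRuns, deletionSphere_zero]
  | singleton a => cases t <;> simp [numRuns, deletionSphere_zero]
  | cons_cons a b l ihl ihb =>
    rcases t with _ | t
    · simp [deletionSphere_zero]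
    have hinj (c : Bool) : Function.Injective (List.cons c) := List.cons_injective
    by_cases hab : a = b
    · calc _ = (numRuns (b :: l) - (t + 1)).choose (t + 1) := by simp [numRuns, hab]
        _ ≤ _ := ihb b (t + 1)
        _ = (List.cons a '' deletionSphere (t + 1) (b :: l)).ncard :=
          (Set.ncard_image_of_injective _ (hinj a)).symm
        _ ≤ _ := Set.ncard_le_ncard (cons_image_deletionSphere_subset a _ _)
          (finite_deletionSphere _ _)
    · have hdisj : Disjoint (List.cons a '' deletionSphere (t + 1) (b :: l))
          (List.cons b '' deletionSphere t l) := by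
        rw [Set.disjoint_left]
        rintro _ ⟨y, -, rfl⟩ ⟨z, -, h⟩
        exact hab (List.cons.inj h).1.symm
      have hsub : List.cons a '' deletionSphere (t + 1) (b :: l) ∪
          List.cons b '' deletionSphere t l ⊆ deletionSphere (t + 1) (a :: b :: l) := by
        refine Set.union_subset (cons_image_deletionSphere_subset a _ _) ?_
        rintro _ ⟨y, ⟨hy, hl⟩, rfl⟩
        exact ⟨(hy.cons_cons b).cons a, by simp only [List.length_cons]; omega⟩
      have hcard := Set.ncard_le_ncard hsub (finite_deletionSphere _ _)
      rw [Set.ncard_union_eq hdisj ((finite_deletionSphere _ _).image _)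
        ((finite_deletionSphere _ _).image _), Set.ncard_image_of_injective _ (hinj a),
        Set.ncard_image_of_injective _ (hinj b)] at hcard
      refine le_trans ?_ hcard
      refine le_trans ?_ (Nat.add_le_add (ihb b (t + 1)) (ihl t))
      have hr := numRuns_cons_le b l
      simp only [numRuns, hab, if_false]
      rcases Nat.lt_or_ge t (numRuns (b :: l)) with h | h
      · obtain ⟨m, hm⟩ := Nat.exists_eq_add_of_lt h
        rw [hm, show t + m + 1 + 1 - (t + 1) = m + 1 by omega,
          show t + m + 1 - (t + 1) = m by omega, Nat.choose_succ_succ, add_comm]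
        exact Nat.add_le_add_left (Nat.choose_le_choose t (by omega)) _
      · rw [show numRuns (b :: l) + 1 - (t + 1) = 0 by omega]
        simp

/-- The upper bound for a deletion sphere, proved together with a bound for the words of
`dSᵗ⁺¹(a :: x)` that cannot be obtained by deleting the first letter `a`. Such a word keeps the whole
first run of `a :: x`, so it costs one run; the two bounds then add up by the recursion for
`Nat.multichoose`. -/
theorem ncard_deletionSphere_le_multichoose_aux (x : List Bool) :
    (∀ t, (deletionSphere t x).ncard ≤ (numRuns x).multichoose t) ∧
      ∀ a t, (deletionSphere (t + 1) (a :: x) \ deletionSphere t x).ncard ≤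
        (numRuns (a :: x) - 1).multichoose (t + 1) := by
  induction x with
  | nil =>
    refine ⟨fun t => ?_, fun a t => ?_⟩
    · rcases t with _ | t
      · simp [deletionSphere_zero]
      · have : deletionSphere (t + 1) [] = ∅ := by
          ext y; simp [deletionSphere]
        simp [this]
    · have : deletionSphere (t + 1) [a] \ deletionSphere t [] = ∅ := by
        refine Set.eq_empty_of_forall_notMem ?_
        rintro y ⟨⟨-, hl⟩, hn⟩
        simp only [List.length_cons, List.length_nil] at hl
        obtain rfl : y = [] := List.length_eq_zero_iff.1 (by omega)
        obtain rfl : t = 0 := by simpa using hl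
        exact hn ⟨List.Sublist.refl _, rfl⟩
      simp [this]
  | cons b l ih =>
    obtain ⟨ihP, ihQ⟩ := ih
    have hP : ∀ t, (deletionSphere t (b :: l)).ncard ≤ (numRuns (b :: l)).multichoose t := by
      rintro (_ | t)
      · simp [deletionSphere_zero]
      obtain ⟨r, hr⟩ := Nat.exists_eq_add_of_le' (one_le_numRuns_cons b l)
      calc _ ≤ (deletionSphere (t + 1) (b :: l) \ deletionSphere t l).ncard +
            (deletionSphere t l).ncard :=
          Set.ncard_le_ncard_sdiff_add_ncard _ _ (finite_deletionSphere _ _)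
        _ ≤ (numRuns (b :: l) - 1).multichoose (t + 1) + (numRuns (b :: l)).multichoose t :=
          Nat.add_le_add (ihQ b t) ((ihP t).trans
            (multichoose_le_multichoose_left (numRuns_le_numRuns_cons b l) t))
        _ = _ := by rw [hr, Nat.multichoose_succ_succ, Nat.add_sub_cancel]
    refine ⟨hP, fun a t => ?_⟩
    by_cases hab : a = b
    · subst hab
      have hsub : deletionSphere (t + 1) (a :: a :: l) \ deletionSphere t (a :: l) ⊆
          List.cons a '' (deletionSphere (t + 1) (a :: l) \ deletionSphere t l) := by
        rintro y ⟨⟨hy, hl⟩, hn⟩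
        simp only [List.length_cons] at hl
        rcases List.sublist_cons_iff.1 hy with h | ⟨z, rfl, hz⟩
        · exact absurd ⟨h, by simp only [List.length_cons]; omega⟩ hn
        · simp only [List.length_cons] at hl
          -- If `z` avoided the first `a` of `a :: l`, then `a :: z` would avoid that of `a :: a :: l`.
          refine ⟨z, ⟨⟨hz, by simp only [List.length_cons]; omega⟩, fun hzl => hn ?_⟩, rfl⟩
          exact ⟨hzl.1.cons_cons a, by simp only [List.length_cons]; omega⟩
      calc _ ≤ _ := Set.ncard_le_ncard hsub ((finite_deletionSphere _ _).sdiff.image _)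
        _ = _ := Set.ncard_image_of_injective _ List.cons_injective
        _ ≤ _ := ihQ a t
        _ = _ := by simp [numRuns]
    · have hsub : deletionSphere (t + 1) (a :: b :: l) \ deletionSphere t (b :: l) ⊆
          List.cons a '' deletionSphere (t + 1) (b :: l) := by
        rintro y ⟨⟨hy, hl⟩, hn⟩
        simp only [List.length_cons] at hl
        rcases List.sublist_cons_iff.1 hy with h | ⟨z, rfl, hz⟩
        · exact absurd ⟨h, by simp only [List.length_cons]; omega⟩ hn
        · simp only [List.length_cons] at hl
          exact ⟨z, ⟨hz, by simp only [List.length_cons]; omega⟩, rfl⟩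
      calc _ ≤ _ := Set.ncard_le_ncard hsub ((finite_deletionSphere _ _).image _)
        _ = _ := Set.ncard_image_of_injective _ List.cons_injective
        _ ≤ _ := hP (t + 1)
        _ = _ := by simp [numRuns, hab]

theorem ncard_deletionSphere_le_multichoose (x : List Bool) (t : ℕ) :
    (deletionSphere t x).ncard ≤ (numRuns x).multichoose t :=
  (ncard_deletionSphere_le_multichoose_aux x).1 t

/-! ### Concentration of the number of runs -/

/-- Prepending a letter to a nonempty word changes `2 r(x) - n` by `1` or by `-1`, according to the
letter chosen, so this sum is multiplicative in the length. -/
theorem sum_cosh_numRuns (s : ℝ) (n : ℕ) :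
    ∑ x ∈ (finite_binaryWords n).toFinset, Real.cosh (s * (2 * numRuns x - n)) =
      (2 * Real.cosh s) ^ n := by
  induction n with
  | zero =>
    have : (finite_binaryWords 0).toFinset = {[]} := by
      ext x; simp [binaryWords]
    simp [this, numRuns]
  | succ n ih =>
    have hsplit : (finite_binaryWords (n + 1)).toFinset =
        ((Finset.univ : Finset Bool) ×ˢ (finite_binaryWords n).toFinset).image
          fun p => p.1 :: p.2 := by
      ext x
      cases x <;> simp [binaryWords]
    rw [hsplit, Finset.sum_image (by rintro ⟨a, x⟩ - ⟨b, y⟩ - h; simpa using h),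
      Finset.sum_product_right, pow_succ, ← ih, Finset.sum_mul]
    refine Finset.sum_congr rfl fun x hx => ?_
    have key : ∀ y : ℝ, Real.cosh (y + s) + Real.cosh (y - s) =
        Real.cosh y * (2 * Real.cosh s) := fun y => by
      rw [Real.cosh_add, Real.cosh_sub]; ring
    rw [Fintype.sum_bool]
    rw [← key]
    cases x with
    | nil =>
      obtain rfl : n = 0 := by simpa [binaryWords, eq_comm] using hx
      -- For the empty word both letters give deviation `1`; the evenness of `cosh` repairs this.
      rw [show s * (2 * (numRuns [] : ℝ) - (0 : ℕ)) - s = -(s * (2 * 1 - 1)) by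
        simp [numRuns]; ring, Real.cosh_neg]
      simp [numRuns]
      norm_num
    | cons b l =>
      have hsame : numRuns (b :: b :: l) = numRuns (b :: l) := by simp [numRuns]
      have hdiff : numRuns ((!b) :: b :: l) = numRuns (b :: l) + 1 := by simp [numRuns]
      cases b
      · rw [hsame, show true = !false from rfl, hdiff]
        push_cast
        congr 2 <;> ring
      · rw [hsame, show false = !true from rfl, hdiff, add_comm]
        push_cast
        congr 2 <;> ring

/-- The words of length `n` whose number of runs differs from `n / 2` by at least `K / 2`. -/
def atypicalWords (n : ℕ) (K : ℝ) : Set (List Bool) :=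
  {x | x ∈ binaryWords n ∧ K ≤ |2 * (numRuns x : ℝ) - n|}

theorem finite_atypicalWords (n : ℕ) (K : ℝ) : (atypicalWords n K).Finite :=
  (finite_binaryWords n).subset fun _ hx => hx.1

/-- The exponential Markov inequality for `sum_cosh_numRuns`, with `cosh s ≤ exp (s ^ 2 / 2)`. -/
theorem ncard_atypicalWords_le (n : ℕ) {K s : ℝ} (hK : 0 ≤ K) (hs : 0 ≤ s) :
    ((atypicalWords n K).ncard : ℝ) ≤ 2 * 2 ^ n * Real.exp (n * s ^ 2 / 2 - s * K) := by
  have hmarkov : ((atypicalWords n K).ncard : ℝ) * Real.cosh (s * K) ≤ (2 * Real.cosh s) ^ n := by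
    rw [← sum_cosh_numRuns s n, Set.ncard_eq_toFinset_card _ (finite_atypicalWords n K),
      ← nsmul_eq_mul]
    refine (Finset.card_nsmul_le_sum _ (fun x => Real.cosh (s * (2 * numRuns x - n))) _ ?_).trans
      (Finset.sum_le_sum_of_subset_of_nonneg ?_ fun x _ _ => (Real.cosh_pos _).le)
    · intro x hx
      have hx' : K ≤ |2 * (numRuns x : ℝ) - n| := ((Set.Finite.mem_toFinset _).1 hx).2
      rw [Real.cosh_le_cosh, abs_mul, abs_mul, abs_of_nonneg hs, abs_of_nonneg hK]
      gcongr
    · intro x hx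
      simp only [Set.Finite.mem_toFinset] at hx ⊢
      exact hx.1
  have hexp : Real.exp (s * K) ≤ 2 * Real.cosh (s * K) := by
    rw [Real.cosh_eq]
    linarith [Real.exp_pos (-(s * K))]
  have hcosh : (2 * Real.cosh s) ^ n ≤ 2 ^ n * Real.exp (n * s ^ 2 / 2) := by
    rw [mul_pow, show (n : ℝ) * s ^ 2 / 2 = n * (s ^ 2 / 2) by ring, Real.exp_nat_mul]
    gcongr
    exact Real.cosh_le_exp_half_sq s
  rw [Real.exp_sub, ← mul_div_assoc, le_div_iff₀ (Real.exp_pos _)]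
  calc _ ≤ ((atypicalWords n K).ncard : ℝ) * (2 * Real.cosh (s * K)) := by gcongr
    _ ≤ _ := by linarith

/-! ### Sphere counting -/

theorem IsDeletionCode.sum_ncard_deletionSphere {t : ℕ} {D : Set (List Bool)}
    (hD : IsDeletionCode t D) (hfin : D.Finite) :
    ∑ x ∈ hfin.toFinset, (deletionSphere t x).ncard = (deletionSphereSet t D).ncard := by
  classical
  have h : deletionSphereSet t D =
      ↑(hfin.toFinset.biUnion fun x => (finite_deletionSphere t x).toFinset) := by
    ext y; simp [deletionSphereSet]
  rw [h, Set.ncard_coe_finset, Finset.card_biUnion]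
  · exact Finset.sum_congr rfl fun x _ => Set.ncard_eq_toFinset_card _ _
  · intro c hc d hd hcd
    rw [Function.onFun, Set.Finite.disjoint_toFinset, Set.disjoint_iff_inter_eq_empty]
    exact hD c (by simpa using hc) d (by simpa using hd) hcd

theorem IsDeletionCodeOfLength.deletionSphereSet_subset {t n : ℕ} {D : Set (List Bool)}
    (hD : IsDeletionCodeOfLength t n D) : deletionSphereSet t D ⊆ binaryWords (n - t) := by
  intro y hy
  obtain ⟨x, hx, hy⟩ := Set.mem_iUnion₂.1 hy
  have hxn : x.length = n := hD.2 hx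
  exact hxn ▸ deletionSphere_subset_binaryWords t x hy

theorem pow_div_factorial_le_ncard_deletionSphere (t : ℕ) (x : List Bool) {b : ℝ} (hb : 0 ≤ b)
    (h : b ≤ numRuns x - 2 * t) : b ^ t / t.factorial ≤ (deletionSphere t x).ncard := by
  have hr : 2 * t ≤ numRuns x := by
    have : ((2 * t : ℕ) : ℝ) ≤ numRuns x := by push_cast; linarith
    exact_mod_cast this
  calc b ^ t / t.factorial ≤ ((numRuns x - t + 1 - t : ℕ) : ℝ) ^ t / t.factorial := by
        gcongr
        refine h.trans ?_
        rw [show numRuns x - t + 1 - t = numRuns x - 2 * t + 1 by omega]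
        push_cast [Nat.cast_sub hr]
        linarith
    _ ≤ ((numRuns x - t).choose t : ℕ) := by exact_mod_cast Nat.pow_le_choose t (numRuns x - t)
    _ ≤ _ := by exact_mod_cast choose_le_ncard_deletionSphere x t

theorem ncard_deletionSphere_le_pow_div_factorial (t : ℕ) (x : List Bool) :
    ((deletionSphere t x).ncard : ℝ) ≤ ((numRuns x : ℝ) + t) ^ t / t.factorial := by
  calc ((deletionSphere t x).ncard : ℝ) ≤ ((numRuns x + t - 1).choose t : ℕ) := by
        rw [← Nat.multichoose_eq]
        exact_mod_cast ncard_deletionSphere_le_multichoose x t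
    _ ≤ ((numRuns x + t - 1 : ℕ) : ℝ) ^ t / t.factorial := Nat.choose_le_pow_div t _
    _ ≤ _ := by
        gcongr
        exact_mod_cast Nat.sub_le _ 1

/-- The sphere-packing bound, where only typical codewords are charged with their spheres; `b` is a
lower bound for `numRuns x - 2 * t` on typical words `x`. -/
theorem IsDeletionCodeOfLength.ncard_le {t n : ℕ} {D : Set (List Bool)}
    (hD : IsDeletionCodeOfLength t n D) (htn : t ≤ n) {b K : ℝ} (hb : 0 < b)
    (hbK : b ≤ (n - K) / 2 - 2 * t) :
    (D.ncard : ℝ) ≤ (atypicalWords n K).ncard + 2 ^ n / 2 ^ t / (b ^ t / t.factorial) := by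
  have hfin : D.Finite := (finite_binaryWords n).subset hD.2
  have hsub : (D \ atypicalWords n K).Finite := hfin.sdiff
  have hbt : 0 < b ^ t / t.factorial := by positivity
  have htyp : ((D \ atypicalWords n K).ncard : ℝ) * (b ^ t / t.factorial) ≤ 2 ^ n / 2 ^ t := by
    calc ((D \ atypicalWords n K).ncard : ℝ) * (b ^ t / t.factorial)
        ≤ ∑ x ∈ hsub.toFinset, ((deletionSphere t x).ncard : ℝ) := by
          rw [Set.ncard_eq_toFinset_card _ hsub, ← nsmul_eq_mul]
          refine Finset.card_nsmul_le_sum _ _ _ fun x hx => ?_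
          obtain ⟨hxD, hx⟩ := (Set.Finite.mem_toFinset _).1 hx
          have hK : |2 * (numRuns x : ℝ) - n| < K := by
            by_contra hcon
            exact hx ⟨hD.2 hxD, not_lt.1 hcon⟩
          exact pow_div_factorial_le_ncard_deletionSphere t x hb.le
            (by linarith [neg_lt_of_abs_lt hK])
      _ ≤ ∑ x ∈ hfin.toFinset, ((deletionSphere t x).ncard : ℝ) :=
          Finset.sum_le_sum_of_subset_of_nonneg
            (Set.Finite.toFinset_mono Set.sdiff_subset) fun _ _ _ => by positivity
      _ = ((deletionSphereSet t D).ncard : ℕ) := by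
          rw [← hD.1.sum_ncard_deletionSphere hfin]; push_cast; rfl
      _ ≤ ((2 ^ (n - t) : ℕ) : ℝ) := by
          rw [← ncard_binaryWords]
          exact_mod_cast Set.ncard_le_ncard hD.deletionSphereSet_subset (finite_binaryWords _)
      _ = 2 ^ n / 2 ^ t := by push_cast; rw [pow_sub₀ _ two_ne_zero htn, div_eq_mul_inv]
  have hcard : (D.ncard : ℝ) ≤ (D \ atypicalWords n K).ncard + (atypicalWords n K).ncard := by
    exact_mod_cast Set.ncard_le_ncard_sdiff_add_ncard D _ (finite_atypicalWords n K)
  rw [← le_div_iff₀ hbt] at htyp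
  linarith

/-- The sphere-covering bound: a typical word contributes at most its sphere bound, an atypical one
at most the bound `(2 * n) ^ t / t!` valid for every word of length `n`. -/
theorem IsPerfectDeletionCode.two_pow_le {t n : ℕ} {D : Set (List Bool)}
    (hD : IsPerfectDeletionCode t n D) {K : ℝ} (hK : 0 ≤ K) :
    (2 : ℝ) ^ n / 2 ^ t ≤ D.ncard * (((n + K) / 2 + t) ^ t / t.factorial) +
      (atypicalWords n K).ncard * ((2 * n) ^ t / t.factorial) := by
  obtain ⟨htn, hcode, hcover⟩ := hD
  have hfin : D.Finite := (finite_binaryWords n).subset hcode.2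
  classical
  have hU : 0 ≤ ((n + K) / 2 + t) ^ t / (t.factorial : ℝ) := by positivity
  have hpt : ∀ x ∈ hfin.toFinset, ((deletionSphere t x).ncard : ℝ) ≤
      ((n + K) / 2 + t) ^ t / t.factorial +
        if x ∈ atypicalWords n K then (2 * n : ℝ) ^ t / t.factorial else 0 := by
    intro x hx
    have hxn : x ∈ binaryWords n := hcode.2 ((Set.Finite.mem_toFinset _).1 hx)
    refine (ncard_deletionSphere_le_pow_div_factorial t x).trans ?_
    split_ifs with hat
    · have hr : (numRuns x : ℝ) ≤ n := by
        have hlen : x.length = n := hxn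
        exact_mod_cast hlen ▸ numRuns_le_length x
      have htn' : (t : ℝ) ≤ n := by exact_mod_cast htn
      refine le_add_of_nonneg_of_le hU ?_
      gcongr
      linarith
    · have hlt : |2 * (numRuns x : ℝ) - n| < K := by
        by_contra hcon
        exact hat ⟨hxn, not_lt.1 hcon⟩
      rw [add_zero]
      gcongr
      linarith [lt_of_abs_lt hlt]
  have hfilter : ((hfin.toFinset.filter (· ∈ atypicalWords n K)).card : ℝ) ≤
      (atypicalWords n K).ncard := by
    rw [Set.ncard_eq_toFinset_card _ (finite_atypicalWords n K)]
    exact_mod_cast Finset.card_le_card fun x hx => by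
      simpa using (Finset.mem_filter.1 hx).2
  calc (2 : ℝ) ^ n / 2 ^ t = ((2 ^ (n - t) : ℕ) : ℝ) := by
        push_cast; rw [pow_sub₀ _ two_ne_zero htn, div_eq_mul_inv]
    _ = ∑ x ∈ hfin.toFinset, ((deletionSphere t x).ncard : ℝ) := by
        rw [← ncard_binaryWords, ← hcover, ← hcode.1.sum_ncard_deletionSphere hfin]
        push_cast; rfl
    _ ≤ _ := Finset.sum_le_sum hpt
    _ = D.ncard * (((n + K) / 2 + t) ^ t / t.factorial) +
          (hfin.toFinset.filter (· ∈ atypicalWords n K)).card * ((2 * n) ^ t / t.factorial) := by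
        rw [Finset.sum_add_distrib, Finset.sum_const, ← Finset.sum_filter, Finset.sum_const,
          nsmul_eq_mul, nsmul_eq_mul, Set.ncard_eq_toFinset_card _ hfin]
    _ ≤ _ := by gcongr

/-! ### Normalized bounds and the limit -/

/-- The sphere-packing bound divided by `t! 2 ^ n / n ^ t`, with run deviation `K = c * n`. The
Markov parameter is `s = c`, which minimizes `n * s ^ 2 / 2 - s * K`. -/
theorem IsDeletionCodeOfLength.ncard_div_le {t n : ℕ} {D : Set (List Bool)}
    (hD : IsDeletionCodeOfLength t n D) (htn : t ≤ n) (hn : 0 < n) {c : ℝ} (hc : 0 ≤ c)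
    (hct : 0 < 1 - c - 4 * t / n) :
    (D.ncard : ℝ) / (t.factorial * 2 ^ n / n ^ t) ≤
      2 / t.factorial * (n ^ t * Real.exp (-(n * c ^ 2 / 2))) + ((1 - c - 4 * t / n)⁻¹) ^ t := by
  have hn' : (0 : ℝ) < n := by exact_mod_cast hn
  have hf : (0 : ℝ) < t.factorial := by exact_mod_cast t.factorial_pos
  have hb := hD.ncard_le htn (b := n * (1 - c - 4 * t / n) / 2) (K := c * n) (by positivity)
    (le_of_eq (by field_simp; ring))
  have hat := ncard_atypicalWords_le n (K := c * n) (s := c) (by positivity) hc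
  rw [show (n : ℝ) * c ^ 2 / 2 - c * (c * n) = -(n * c ^ 2 / 2) by ring] at hat
  generalize 1 - c - 4 * (t : ℝ) / n = u at *
  rw [div_le_iff₀ (by positivity)]
  refine (hb.trans (add_le_add_left hat _)).trans (le_of_eq ?_)
  rw [div_pow, mul_pow, inv_pow]
  field_simp

/-- The sphere-covering bound divided by `t! 2 ^ n / n ^ t`, with run deviation `K = c * n`. -/
theorem IsPerfectDeletionCode.le_ncard_div {t n : ℕ} {D : Set (List Bool)}
    (hD : IsPerfectDeletionCode t n D) (hn : 0 < n) {c : ℝ} (hc : 0 ≤ c) :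
    (1 - 2 ^ (2 * t + 1) / t.factorial * (n ^ t * Real.exp (-(n * c ^ 2 / 2)))) *
        ((1 + c + 2 * t / n)⁻¹) ^ t ≤
      (D.ncard : ℝ) / (t.factorial * 2 ^ n / n ^ t) := by
  have hn' : (0 : ℝ) < n := by exact_mod_cast hn
  have hf : (0 : ℝ) < t.factorial := by exact_mod_cast t.factorial_pos
  have hlow := hD.two_pow_le (K := c * n) (by positivity)
  have hat := ncard_atypicalWords_le n (K := c * n) (s := c) (by positivity) hc
  rw [show (n : ℝ) * c ^ 2 / 2 - c * (c * n) = -(n * c ^ 2 / 2) by ring] at hat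
  have hu : 0 < 1 + c + 2 * (t : ℝ) / n := by positivity
  rw [show (n + c * n) / 2 + (t : ℝ) = n * (1 + c + 2 * (t : ℝ) / n) / 2 by
    field_simp] at hlow
  generalize 1 + c + 2 * (t : ℝ) / n = u at *
  generalize Real.exp (-(n * c ^ 2 / 2)) = e at *
  have hlow' := hlow.trans (add_le_add_right
    (mul_le_mul_of_nonneg_right hat (by positivity : (0 : ℝ) ≤ (2 * n) ^ t / t.factorial)) _)
  rw [le_div_iff₀ (by positivity), inv_pow, ← div_eq_mul_inv, div_mul_eq_mul_div,
    div_le_iff₀ (by positivity)]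
  have hmul := mul_le_mul_of_nonneg_left hlow'
    (by positivity : (0 : ℝ) ≤ t.factorial * 2 ^ t / n ^ t)
  have h1 : t.factorial * 2 ^ t / (n : ℝ) ^ t * (2 ^ n / 2 ^ t) = t.factorial * 2 ^ n / n ^ t := by
    field_simp
  have h2 : t.factorial * 2 ^ t / (n : ℝ) ^ t *
      (D.ncard * ((n * u / 2) ^ t / t.factorial) +
        2 * 2 ^ n * e * ((2 * n) ^ t / t.factorial)) =
      D.ncard * u ^ t + 2 ^ (2 * t + 1) / t.factorial * (n ^ t * e) *
        (t.factorial * 2 ^ n / n ^ t) := by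
    rw [div_pow, mul_pow, mul_pow, pow_succ, mul_comm 2 t, pow_mul]
    field_simp
  rw [h1, h2] at hmul
  linarith

theorem tendsto_pow_mul_exp_neg_sqrt (t : ℕ) :
    Tendsto (fun n : ℕ => (n : ℝ) ^ t * Real.exp (-(n * ((n : ℝ) ^ (-1 / 4 : ℝ)) ^ 2 / 2)))
      atTop (𝓝 0) := by
  have h := (tendsto_rpow_mul_exp_neg_mul_atTop_nhds_zero (2 * t : ℝ) (1 / 2) (by norm_num)).comp
    ((tendsto_rpow_atTop (by norm_num : (0 : ℝ) < 1 / 2)).comp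
      (tendsto_natCast_atTop_atTop (R := ℝ)))
  refine h.congr' ?_
  filter_upwards [eventually_gt_atTop 0] with n hn
  have hn' : (0 : ℝ) < n := by exact_mod_cast hn
  have h1 : (n : ℝ) * ((n : ℝ) ^ (-1 / 4 : ℝ)) ^ 2 = (n : ℝ) ^ (1 / 2 : ℝ) := by
    rw [← Real.rpow_natCast, ← Real.rpow_mul hn'.le, ← Real.rpow_one_add' hn'.le (by norm_num)]
    norm_num
  have h2 : ((n : ℝ) ^ (1 / 2 : ℝ)) ^ (2 * t : ℝ) = (n : ℝ) ^ t := by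
    rw [← Real.rpow_mul hn'.le, ← Real.rpow_natCast]
    congr 1
    ring
  simp only [Function.comp, h1, h2]
  congr 2
  ring

theorem theorem1 (t : ℕ) (ht : 0 < t) (A : Set ℕ) (hA : A.Infinite)
    (C : ℕ → Set (List Bool)) (hC : ∀ n ∈ A, IsPerfectDeletionCode t n (C n)) :
    Tendsto (fun n : ℕ => ((C n).ncard : ℝ) / (maxDeletionCodeCard t n : ℝ))
        (atTop ⊓ 𝓟 A) (𝓝 1) ∧
      Tendsto (fun n : ℕ => (maxDeletionCodeCard t n : ℝ) /
          ((Nat.factorial t : ℝ) * (2 : ℝ) ^ n / (n : ℝ) ^ t))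
        (atTop ⊓ 𝓟 A) (𝓝 1) := by
  -- The relative run deviation: it tends to `0`, yet `n * c n ^ 2 = √n` outgrows `log n`.
  set c : ℕ → ℝ := fun n => (n : ℝ) ^ (-1 / 4 : ℝ) with hc
  have hc0 : Tendsto c atTop (𝓝 0) := by
    have := (tendsto_rpow_neg_atTop (by norm_num : (0 : ℝ) < 1 / 4)).comp
      (tendsto_natCast_atTop_atTop (R := ℝ))
    refine this.congr fun n => ?_
    simp only [hc, Function.comp]
    norm_num
  have hcnn (n : ℕ) : 0 ≤ c n := by positivity
  have hexp := tendsto_pow_mul_exp_neg_sqrt t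
  have hdiv (a : ℝ) : Tendsto (fun n : ℕ => a / n) atTop (𝓝 0) :=
    tendsto_const_div_atTop_nhds_zero_nat a
  have hbase : Tendsto (fun n : ℕ => 1 - c n - 4 * t / n) atTop (𝓝 1) := by
    simpa using (hc0.const_sub 1).sub (hdiv (4 * t))
  have hupper : Tendsto (fun n : ℕ => 2 / t.factorial * ((n : ℝ) ^ t *
      Real.exp (-(n * c n ^ 2 / 2))) + ((1 - c n - 4 * t / n)⁻¹) ^ t) atTop (𝓝 1) := by
    simpa using (hexp.const_mul (2 / (t.factorial : ℝ))).add
      ((hbase.inv₀ one_ne_zero).pow t)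
  have hlower : Tendsto (fun n : ℕ => (1 - 2 ^ (2 * t + 1) / t.factorial * ((n : ℝ) ^ t *
      Real.exp (-(n * c n ^ 2 / 2)))) * ((1 + c n + 2 * t / n)⁻¹) ^ t) atTop (𝓝 1) := by
    have h1 : Tendsto (fun n : ℕ => 1 + c n + 2 * t / n) atTop (𝓝 1) := by
      simpa using (hc0.const_add 1).add (hdiv (2 * t))
    simpa using ((hexp.const_mul (2 ^ (2 * t + 1) / (t.factorial : ℝ))).const_sub 1).mul
      ((h1.inv₀ one_ne_zero).pow t)
  have hle : (atTop ⊓ 𝓟 A : Filter ℕ) ≤ atTop := inf_le_left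
  have hev : ∀ᶠ n : ℕ in atTop ⊓ 𝓟 A, n ∈ A ∧ 0 < n ∧ 0 < 1 - c n - 4 * t / n :=
    (eventually_inf_principal.2 (.of_forall fun _ h => h)).and (hle
      ((eventually_gt_atTop 0).and (hbase.eventually_const_lt one_pos)))
  have hCM : ∀ n ∈ A, (C n).ncard ≤ maxDeletionCodeCard t n := fun n hn =>
    (isGreatest_maxDeletionCodeCard t n).2 ⟨C n, (hC n hn).2.1, rfl⟩
  have hMle : ∀ᶠ n : ℕ in atTop ⊓ 𝓟 A, (maxDeletionCodeCard t n : ℝ) /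
      (t.factorial * 2 ^ n / n ^ t) ≤ 2 / t.factorial * ((n : ℝ) ^ t *
      Real.exp (-(n * c n ^ 2 / 2))) + ((1 - c n - 4 * t / n)⁻¹) ^ t := by
    filter_upwards [hev] with n ⟨hn, hpos, hb⟩
    obtain ⟨D, hD, hDM⟩ := (isGreatest_maxDeletionCodeCard t n).1
    rw [← hDM]
    exact hD.ncard_div_le (hC n hn).1 hpos (hcnn n) hb
  have hleC : ∀ᶠ n : ℕ in atTop ⊓ 𝓟 A, (1 - 2 ^ (2 * t + 1) / t.factorial * ((n : ℝ) ^ t *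
      Real.exp (-(n * c n ^ 2 / 2)))) * ((1 + c n + 2 * t / n)⁻¹) ^ t ≤
      ((C n).ncard : ℝ) / (t.factorial * 2 ^ n / n ^ t) := by
    filter_upwards [hev] with n ⟨hn, hpos, _⟩
    exact (hC n hn).le_ncard_div hpos (hcnn n)
  have hCM' : ∀ᶠ n : ℕ in atTop ⊓ 𝓟 A, ((C n).ncard : ℝ) / (t.factorial * 2 ^ n / n ^ t) ≤
      (maxDeletionCodeCard t n : ℝ) / (t.factorial * 2 ^ n / n ^ t) := by
    filter_upwards [hev] with n ⟨hn, _⟩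
    have : ((C n).ncard : ℝ) ≤ maxDeletionCodeCard t n := by exact_mod_cast hCM n hn
    gcongr
  have hM := tendsto_of_tendsto_of_tendsto_of_le_of_le' (hlower.mono_left hle)
    (hupper.mono_left hle) (EventuallyLE.trans hleC hCM') hMle
  have hCn := tendsto_of_tendsto_of_tendsto_of_le_of_le' (hlower.mono_left hle)
    (hupper.mono_left hle) hleC (EventuallyLE.trans hCM' hMle)
  refine ⟨?_, hM⟩
  have hquot := hCn.div hM one_ne_zero
  rw [div_one] at hquot
  refine hquot.congr' ?_
  filter_upwards [hev] with n ⟨_, hpos, _⟩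
  have hn' : (0 : ℝ) < n := by exact_mod_cast hpos
  exact div_div_div_cancel_right₀ (by positivity) _ _
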